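/- Let $d\ge s\ge 1$ be integers and let $\mathbb{L}^d=(\mathbb{Z}^d,\mathbb{E}^d)$ be the hypercubic lattice, where $\mathbb{E}^d=\{\{x,y\}\subset\mathbb{Z}^d:\|x-y\|_1=1\}$. Put $H=\mathbb{Z}^s\times\{0\}^{d-s}$. For $(p,q)\in[0,1]^2$, let $P_{p,q}$ be the bond percolation measure on $\{0,1\}^{\mathbb{E}^d}$ under which the edges are open (state $1$) independently of each other, each edge with both endpoints in $H$ being open with probability $q$ and every other edge being open with probability $p$. Let $E_{p,q}$ be the corresponding expectation, and let $C$ be the cluster of the origin $o$, that is, the set of all $v\in\mathbb{Z}^d$ such that $v=o$ or $v$ is joined to $o$ by a path of open edges. Then the set $$\mathcal{A}=\{(p,q)\in[0,1]^2 : E_{p,q}|C|<\infty\}$$ is open in $[0,1]^2$, with respect to the subspace topology inherited from $\mathbb{R}^2$. -/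

import Mathlib

open MeasureTheory ProbabilityTheory
open scoped ENNReal unitInterval

noncomputable section

namespace DefectPercolation

/-- The hypercubic lattice on `ℤ^d`: two vertices are adjacent when their `ℓ¹` distance is `1`. -/
def lattice (d : ℕ) : SimpleGraph (Fin d → ℤ) where
  Adj x y := ∑ i, |x i - y i| = 1
  symm := ⟨fun x y h => by simpa only [abs_sub_comm] using h⟩
  loopless := ⟨fun x h => by simp at h⟩

/-- The edges of the hypercubic lattice. -/
abbrev Edge (d : ℕ) : Type := (lattice d).edgeSet

/-- Percolation configurations: `true` means open and `false` means closed.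
The σ-algebra is the product one, generated by finite-dimensional cylinders. -/
abbrev Config (d : ℕ) : Type := Edge d → Bool

/-- The sublattice `H = ℤ^s × {0}^(d-s)` of `ℤ^d`. -/
def sublattice (d s : ℕ) : Set (Fin d → ℤ) := {x | ∀ i : Fin d, s ≤ (i : ℕ) → x i = 0}

/-- The edges of the lattice with both endpoints in the sublattice `H`. -/
def sublatticeEdges (d s : ℕ) : Set (Edge d) :=
  {e | ∀ x ∈ (e : Sym2 (Fin d → ℤ)), x ∈ sublattice d s}

open Classical in
/-- The parameter of an edge: `q` inside the sublattice and `p` elsewhere. -/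
def edgeParam (d s : ℕ) (p q : I) (e : Edge d) : I :=
  if e ∈ sublatticeEdges d s then q else p

/-- The measure `P_{p,q}`: edges are independent, each open with its own parameter. -/
def percMeasure (d s : ℕ) (p q : I) : Measure (Config d) :=
  Measure.infinitePi fun e => bernoulliMeasure true false (edgeParam d s p q e)

/-- The graph on `ℤ^d` formed by the open edges of a configuration. -/
def openGraph {d : ℕ} (ω : Config d) : SimpleGraph (Fin d → ℤ) where
  Adj x y := ∃ h : (lattice d).Adj x y, ω ⟨s(x, y), h⟩ = true
  symm := ⟨fun x y ⟨h, hω⟩ => ⟨h.symm, by simpa only [Sym2.eq_swap] using hω⟩⟩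
  loopless := ⟨fun x ⟨h, _⟩ => (lattice d).loopless.irrefl x h⟩

/-- The cluster of `u`: all vertices joined to `u` by an open path (including `u`). -/
def cluster {d : ℕ} (ω : Config d) (u : Fin d → ℤ) : Set (Fin d → ℤ) :=
  {v | (openGraph ω).Reachable u v}

/-- The expected number of vertices of the cluster of the origin, a value in `[1, ∞]`. -/
def expectedClusterSize (d s : ℕ) (p q : I) : ℝ≥0∞ :=
  ∫⁻ ω, ((cluster ω 0).encard : ℝ≥0∞) ∂(percMeasure d s p q)

/-- The set of parameters `(p, q) ∈ [0,1]²` for which the expected cluster size is finite. -/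
def subcriticalSet (d s : ℕ) : Set (I × I) :=
  {x | expectedClusterSize d s x.1 x.2 < ∞}

end DefectPercolation

end

/-! Write χ(x) for the mean cluster size of x and τ for the two-point function. The core is an
exploration inequality (`meanSize_parOr_le`). If independent open edges with parameters ε are added
to a configuration in which χ(x) is finite, then χ'(x) ≤ χ(x) + ∑ τ(x,z) ε(z,z+k) χ'(z+k), where the
sum is over vertices z and unit vectors k: a path leaving the old cluster of x makes a last exit
through an added edge and afterwards avoids every edge touching that cluster. If χ ≤ K everywhere
and the coefficients sum to at most δ < 1, then χ' ≤ K / (1 - δ) (`meanSize_le_of_decomposition`).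
With a constant ε = c and 2dcK < 1 this gives openness.

It remains to bound χ(x) uniformly in x when χ(0) is finite (`exists_meanSize_edgeParam_le`). For s
= d this is translation invariance. For s < d, consider homogeneous percolation with parameter p and
the expected number of open exits from the box of radius n. Placing an exit vertex at the origin and
turning the box away from H compares each exit with a connection in the defect model, so these
numbers sum over n to at most 2d χ(0). Hence one of them is below 1, and the exploration inequality
bounds the homogeneous mean size. Finally, explore from x with the edges of H closed: every exit
lands in H, where χ equals χ(0). -/

noncomputable section

namespace DefectPercolation

/-! ### Independent bits: sprinkling, masking, independence. -/

section BernoulliProduct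

variable {ι κ : Type*}

/-- The law of a family of independent bits with the given parameters. -/
def bernoulliProduct (r : ι → I) : Measure (ι → Bool) :=
  Measure.infinitePi fun i => bernoulliMeasure true false (r i)

instance (r : ι → I) : IsProbabilityMeasure (bernoulliProduct r) := by
  unfold bernoulliProduct; infer_instance

/-- The probability that at least one of two independent events occurs. -/
def parOr (a b : I) : I := σ (σ a * σ b)

theorem coe_parOr (a b : I) : (parOr a b : ℝ) = 1 - (1 - a) * (1 - b) := by
  simp [parOr]

theorem parOr_zero_left (a : I) : parOr 0 a = a := by simp [parOr]

theorem parOr_zero_right (a : I) : parOr a 0 = a := by simp [parOr]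

/-- Any larger parameter arises by sprinkling; this yields the monotone coupling in `connProb_mono`.
-/
theorem exists_parOr_eq {a b : I} (h : a ≤ b) : ∃ c, parOr a c = b := by
  have hab : (a : ℝ) ≤ b := h
  rcases eq_or_ne (a : ℝ) 1 with ha | ha
  · refine ⟨0, ?_⟩
    rw [parOr_zero_right]
    exact Subtype.ext (le_antisymm hab (ha ▸ b.2.2))
  · have ha' : 0 < 1 - (a : ℝ) := by
      have := a.2.2
      rcases this.lt_or_eq with h | h
      · linarith
      · exact absurd h ha
    refine ⟨⟨1 - (1 - b) / (1 - a), ?_, ?_⟩, ?_⟩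
    · rw [sub_nonneg, div_le_one ha']; linarith
    · have : 0 ≤ (1 - (b : ℝ)) / (1 - a) := div_nonneg (by linarith [b.2.2]) ha'.le
      linarith
    · apply Subtype.ext
      rw [coe_parOr]
      field_simp
      ring

/-- Close all indices outside of `S`. -/
def mask (S : Set ι) (ω : ι → Bool) (i : ι) : Bool := by
  classical exact if i ∈ S then ω i else false

theorem mask_of_mem {S : Set ι} {i : ι} (h : i ∈ S) (ω : ι → Bool) : mask S ω i = ω i := by
  simp [mask, h]

theorem mask_eq_true {S : Set ι} {ω : ι → Bool} {i : ι} :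
    mask S ω i = true ↔ i ∈ S ∧ ω i = true := by
  by_cases h : i ∈ S <;> simp [mask, h]

theorem measurable_mask (S : Set ι) : Measurable (mask S) := by
  refine measurable_pi_lambda _ fun i => ?_
  by_cases h : i ∈ S
  · simpa [mask, h] using measurable_pi_apply i
  · simp [mask, h]

theorem map_comp_bernoulliProduct (r : ι → I) {f : κ → ι} (hf : f.Injective) :
    (bernoulliProduct r).map (fun ω i => ω (f i)) = bernoulliProduct (fun i => r (f i)) :=
  Measure.map_infinitePi_infinitePi_of_inj hf

open Classical in
theorem map_mask_bernoulliProduct (r : ι → I) (S : Set ι) :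
    (bernoulliProduct r).map (mask S) = bernoulliProduct (S.indicator r) := by
  have h := Measure.infinitePi_map_pi (μ := fun i => bernoulliMeasure true false (r i))
    (f := fun i b => if i ∈ S then b else false) (fun i => measurable_of_finite _)
  refine Eq.trans ?_ (h.trans ?_)
  · rfl
  · unfold bernoulliProduct
    congr 1
    funext i
    by_cases hi : i ∈ S
    · simp [hi]
    · simp [hi]

/-- Two independent families of independent bits, as one family. -/
def pairProduct (r ε : ι → I) : Measure (ι × Bool → Bool) :=
  bernoulliProduct fun p => bif p.2 then ε p.1 else r p.1

instance (r ε : ι → I) : IsProbabilityMeasure (pairProduct r ε) := by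
  unfold pairProduct; infer_instance

theorem map_fst_pairProduct (r ε : ι → I) :
    (pairProduct r ε).map (fun ζ i => ζ (i, false)) = bernoulliProduct r :=
  map_comp_bernoulliProduct _ (f := fun i => (i, false)) fun i j h => by simpa using h

/-- A probability on `Bool` is determined by its mass at `false`, and the disjunction is `false`
exactly on a product set. -/
theorem bernoulli_or (a b : I) :
    (Measure.infinitePi fun j : Bool => bernoulliMeasure true false (bif j then b else a)).map
      (fun f => f false || f true) = bernoulliMeasure true false (parOr a b) := by
  have hm : Measurable (fun f : Bool → Bool => f false || f true) := measurable_of_finite _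
  have : IsProbabilityMeasure ((Measure.infinitePi fun j : Bool =>
      bernoulliMeasure true false (bif j then b else a)).map
      (fun f => f false || f true)) := Measure.isProbabilityMeasure_map hm.aemeasurable
  have key : (Measure.infinitePi fun j : Bool =>
      bernoulliMeasure true false (bif j then b else a)).map
      (fun f => f false || f true) {false} = bernoulliMeasure true false (parOr a b) {false} := by
    rw [Measure.map_apply hm (by simp)]
    have : (fun f : Bool → Bool => f false || f true) ⁻¹' {false} =
        Set.pi ((Finset.univ : Finset Bool) : Set Bool) fun _ => {false} := by
      ext f; simp; tauto
    rw [this, Measure.infinitePi_pi _ (by simp)]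
    simp [parOr]
    rw [mul_comm]
    norm_cast
  refine Measure.ext_of_singleton fun x => ?_
  cases x with
  | false => exact key
  | true =>
    have h : ({true} : Set Bool) = {false}ᶜ := by ext x; cases x <;> simp
    rw [h, prob_compl_eq_one_sub (by simp), prob_compl_eq_one_sub (by simp), key]

theorem map_or_pairProduct (r ε : ι → I) :
    (pairProduct r ε).map (fun ζ i => ζ (i, false) || ζ (i, true)) =
      bernoulliProduct (fun i => parOr (r i) (ε i)) := by
  have h1 := Measure.infinitePi_map_curry (ι := ι) (κ := Bool) (X := Bool)
    (fun i j => bernoulliMeasure true false (bif j then ε i else r i))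
  have h2 := Measure.infinitePi_map_pi
    (μ := fun i => Measure.infinitePi fun j : Bool =>
      bernoulliMeasure true false (bif j then ε i else r i))
    (f := fun _ f => f false || f true) (fun i => measurable_of_finite _)
  rw [← h1, Measure.map_map (by fun_prop) (by fun_prop)] at h2
  simp only [bernoulli_or] at h2
  exact h2

theorem measurable_mask_iSup (S : Set ι) :
    Measurable[⨆ i ∈ S, (inferInstance : MeasurableSpace Bool).comap fun ω : ι → Bool => ω i]
      (mask S) := by
  refine @measurable_pi_lambda _ _ _ (_) _ _ fun i => ?_
  by_cases h : i ∈ S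
  · have : (fun ω : ι → Bool => mask S ω i) = fun ω => ω i := by
      funext ω; exact mask_of_mem h ω
    rw [this]
    exact (comap_measurable _).mono (le_biSup
      (fun i => (inferInstance : MeasurableSpace Bool).comap fun ω : ι → Bool => ω i) h) le_rfl
  · have : (fun ω : ι → Bool => mask S ω i) = fun ω => false := by
      funext ω; simp [mask, h]
    rw [this]
    exact measurable_const

theorem indepFun_mask (r : ι → I) {S T : Set ι} (h : Disjoint S T) :
    IndepFun (mask S) (mask T) (bernoulliProduct r) := by
  have hi : iIndepFun (fun i (ω : ι → Bool) => ω i) (bernoulliProduct r) :=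
    iIndepFun_infinitePi (X := fun _ b => b) (fun _ => measurable_id)
  have := indep_iSup_of_disjoint (m := fun i => (inferInstance : MeasurableSpace Bool).comap
    fun ω : ι → Bool => ω i) (fun i => (measurable_pi_apply i).comap_le) hi h
  exact indep_of_indep_of_le_left (indep_of_indep_of_le_right this
    (measurable_mask_iSup T).comap_le) (measurable_mask_iSup S).comap_le

theorem bernoulliProduct_inter_mask (r : ι → I) {S T : Set ι} (h : Disjoint S T)
    {A B : Set (ι → Bool)} (hA : MeasurableSet A) (hB : MeasurableSet B) :
    bernoulliProduct r ({ω | mask S ω ∈ A} ∩ {ω | mask T ω ∈ B}) =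
      bernoulliProduct r {ω | mask S ω ∈ A} * bernoulliProduct r {ω | mask T ω ∈ B} :=
  (indepFun_mask r h).measure_inter_preimage_eq_mul _ _ hA hB

theorem bernoulliProduct_eval (r : ι → I) (i : ι) :
    bernoulliProduct r {ω | ω i = true} = ENNReal.ofReal (r i) := by
  have h := Measure.infinitePi_map_eval (fun i => bernoulliMeasure true false (r i)) i
  have h2 := DFunLike.congr_fun h {true}
  rw [Measure.map_apply (by fun_prop) (by simp)] at h2
  refine Eq.trans ?_ (h2.trans ?_)
  · rfl
  · rw [bernoulliMeasure_apply_of_mem_of_notMem _ (by simp) (by simp) (by simp), ENNReal.ofReal,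
      Real.toNNReal_of_nonneg (r i).2.1]
    rfl

end BernoulliProduct

/-! ### Clusters, measurability and the two-point function. -/

variable {d : ℕ}

theorem openGraph_mono {ω ω' : Config d} (h : ∀ e, ω e = true → ω' e = true) :
    openGraph ω ≤ openGraph ω' := fun _ _ ⟨hl, ho⟩ => ⟨hl, h _ ho⟩

theorem cluster_mono {ω ω' : Config d} (h : ∀ e, ω e = true → ω' e = true) (x : Fin d → ℤ) :
    cluster ω x ⊆ cluster ω' x := fun _ hy => SimpleGraph.Reachable.mono (openGraph_mono h) hy

theorem self_mem_cluster (ω : Config d) (x : Fin d → ℤ) : x ∈ cluster ω x :=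
  SimpleGraph.Reachable.refl x

theorem cluster_mask_subset (S : Set (Edge d)) (ω : Config d) (x : Fin d → ℤ) :
    cluster (mask S ω) x ⊆ cluster ω x :=
  cluster_mono (fun _ h => (mask_eq_true.1 h).2) x

/-- Induction along open paths, by adding edges at the end. -/
theorem cluster_induction {ω : Config d} {x : Fin d → ℤ} {P : (Fin d → ℤ) → Prop} (h0 : P x)
    (hs : ∀ y z (h : (lattice d).Adj y z), ω ⟨s(y, z), h⟩ = true → y ∈ cluster ω x → P y → P z)
    {y : Fin d → ℤ} (hy : y ∈ cluster ω x) : P y := by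
  have h := (SimpleGraph.reachable_iff_reflTransGen x y).1 hy
  induction h with
  | refl => exact h0
  | tail hab hbc ih =>
    obtain ⟨hl, ho⟩ := hbc
    have hb := (SimpleGraph.reachable_iff_reflTransGen _ _).2 hab
    exact hs _ _ hl ho hb (ih hb)

theorem mem_cluster_step {ω : Config d} {x y z : Fin d → ℤ} (hy : y ∈ cluster ω x)
    (h : (lattice d).Adj y z) (ho : ω ⟨s(y, z), h⟩ = true) : z ∈ cluster ω x :=
  SimpleGraph.Reachable.trans hy (SimpleGraph.Adj.reachable ⟨h, ho⟩)

instance : Countable (Edge d) := by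
  unfold Edge; infer_instance

/-- Every open path uses finitely many edges. -/
theorem exists_finset_mem_cluster_mask {ω : Config d} {x y : Fin d → ℤ} (hy : y ∈ cluster ω x) :
    ∃ F : Finset (Edge d), y ∈ cluster (mask (F : Set (Edge d)) ω) x := by
  classical
  refine cluster_induction (P := fun y => ∃ F : Finset (Edge d),
    y ∈ cluster (mask (F : Set (Edge d)) ω) x) ⟨∅, self_mem_cluster _ _⟩ ?_ hy
  rintro y z h ho - ⟨F, hF⟩
  refine ⟨insert ⟨s(y, z), h⟩ F, mem_cluster_step (cluster_mono ?_ x hF) h ?_⟩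
  · intro e he
    rw [mask_eq_true] at he ⊢
    exact ⟨by simp [Finset.mem_coe.1 he.1], he.2⟩
  · rw [mask_eq_true]
    exact ⟨by simp, ho⟩

/-- No condition on `P` is needed: the masked configuration is a function of finitely many bits. -/
theorem measurable_comp_mask_finset (F : Finset (Edge d)) (P : Config d → Prop) :
    MeasurableSet {ω : Config d | P (mask (F : Set (Edge d)) ω)} := by
  classical
  let g : (F → Bool) → Config d := fun f e => if h : e ∈ F then f ⟨e, h⟩ else false
  have : {ω : Config d | P (mask (F : Set (Edge d)) ω)} =
      (fun ω (e : F) => ω e) ⁻¹' {f | P (g f)} := by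
    ext ω
    simp only [Set.mem_ofPred_eq, Set.mem_preimage]
    have : mask (F : Set (Edge d)) ω = g fun e => ω e := by
      funext e
      by_cases h : e ∈ F <;> simp [mask, g, h]
    rw [this]
  rw [this]
  exact (measurable_pi_lambda _ fun e => measurable_pi_apply _) (Set.toFinite _).measurableSet

theorem mem_cluster_iff_exists_finset {ω : Config d} {x y : Fin d → ℤ} :
    y ∈ cluster ω x ↔ ∃ F : Finset (Edge d), y ∈ cluster (mask (F : Set (Edge d)) ω) x :=
  ⟨exists_finset_mem_cluster_mask, fun ⟨_, h⟩ => cluster_mask_subset _ _ _ h⟩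

theorem setOf_mem_cluster_eq_iUnion (x y : Fin d → ℤ) :
    {ω : Config d | y ∈ cluster ω x} =
      ⋃ F : Finset (Edge d), {ω | y ∈ cluster (mask (F : Set (Edge d)) ω) x} := by
  ext ω
  simp [mem_cluster_iff_exists_finset (ω := ω)]

theorem measurableSet_mem_cluster (x y : Fin d → ℤ) :
    MeasurableSet {ω : Config d | y ∈ cluster ω x} := by
  rw [setOf_mem_cluster_eq_iUnion]
  exact MeasurableSet.iUnion fun F => measurable_comp_mask_finset F fun ω => y ∈ cluster ω x

theorem measurableSet_cluster_eq (x : Fin d → ℤ) (a : Set (Fin d → ℤ)) :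
    MeasurableSet {ω : Config d | cluster ω x = a} := by
  have : {ω : Config d | cluster ω x = a} =
      ⋂ y, {ω : Config d | y ∈ cluster ω x ↔ y ∈ a} := by
    ext ω; simp [Set.ext_iff]
  rw [this]
  refine MeasurableSet.iInter fun y => ?_
  by_cases h : y ∈ a
  · simpa [h] using measurableSet_mem_cluster x y
  · simp only [h, iff_false]
    exact (measurableSet_mem_cluster x y).compl

/-- The two-point function. -/
def connProb (r : Edge d → I) (x y : Fin d → ℤ) : ℝ≥0∞ :=
  bernoulliProduct r {ω | y ∈ cluster ω x}

/-- The expected size of the cluster of `x`. -/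
def meanSize (r : Edge d → I) (x : Fin d → ℤ) : ℝ≥0∞ := ∑' y, connProb r x y

theorem lintegral_encard_cluster (r : Edge d → I) (x : Fin d → ℤ) :
    ∫⁻ ω, ((cluster ω x).encard : ℝ≥0∞) ∂(bernoulliProduct r) = meanSize r x := by
  classical
  have h : ∀ ω : Config d, ((cluster ω x).encard : ℝ≥0∞) =
      ∑' y, {ω : Config d | y ∈ cluster ω x}.indicator (fun _ => (1 : ℝ≥0∞)) ω := by
    intro ω
    rw [← ENNReal.tsum_set_one, tsum_subtype (cluster ω x) (fun _ => (1 : ℝ≥0∞))]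
    rfl
  simp_rw [h]
  rw [lintegral_tsum fun y =>
    (measurable_const.indicator (measurableSet_mem_cluster x y)).aemeasurable]
  refine tsum_congr fun y => ?_
  rw [lintegral_indicator_const (measurableSet_mem_cluster x y), one_mul, connProb]

theorem expectedClusterSize_eq (s : ℕ) (p q : I) :
    expectedClusterSize d s p q = meanSize (edgeParam d s p q) 0 :=
  lintegral_encard_cluster _ _

theorem connProb_le_one (r : Edge d → I) (x y : Fin d → ℤ) : connProb r x y ≤ 1 := prob_le_one

theorem connProb_mono {r r' : Edge d → I} (h : r ≤ r') (x y : Fin d → ℤ) :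
    connProb r x y ≤ connProb r' x y := by
  choose ε hε using fun e => exists_parOr_eq (h e)
  obtain rfl : (fun e => parOr (r e) (ε e)) = r' := funext hε
  unfold connProb
  rw [← map_fst_pairProduct r ε, ← map_or_pairProduct r ε,
    Measure.map_apply (by fun_prop) (measurableSet_mem_cluster x y),
    Measure.map_apply (by fun_prop) (measurableSet_mem_cluster x y)]
  refine measure_mono fun ζ hζ => cluster_mono (fun e he => ?_) x hζ
  simp [he]

theorem meanSize_mono {r r' : Edge d → I} (h : r ≤ r') (x : Fin d → ℤ) :
    meanSize r x ≤ meanSize r' x :=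
  ENNReal.tsum_le_tsum fun y => connProb_mono h x y

theorem connProb_indicator (r : Edge d → I) (S : Set (Edge d)) (x y : Fin d → ℤ) :
    connProb (S.indicator r) x y = bernoulliProduct r {ω | y ∈ cluster (mask S ω) x} := by
  unfold connProb
  rw [← map_mask_bernoulliProduct,
    Measure.map_apply (measurable_mask S) (measurableSet_mem_cluster x y)]
  rfl

theorem monotone_setOf_mem_cluster_mask (x y : Fin d → ℤ) : Monotone fun F : Finset (Edge d) =>
    {ω : Config d | y ∈ cluster (mask (F : Set (Edge d)) ω) x} := by
  intro F G hFG ω hω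
  refine cluster_mono (fun e he => ?_) x hω
  rw [mask_eq_true] at he ⊢
  exact ⟨hFG he.1, he.2⟩

theorem connProb_eq_iSup (r : Edge d → I) (x y : Fin d → ℤ) :
    connProb r x y = ⨆ F : Finset (Edge d), connProb ((F : Set (Edge d)).indicator r) x y := by
  simp_rw [connProb_indicator]
  rw [connProb, setOf_mem_cluster_eq_iUnion]
  exact (monotone_setOf_mem_cluster_mask x y).directed_le.measure_iUnion

/-- Monotone convergence along finite edge sets. It reduces bounds to a setting where the supremum
of mean sizes is known to be finite. -/
theorem meanSize_le_of_finset {r : Edge d → I} {x : Fin d → ℤ} {K : ℝ≥0∞}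
    (h : ∀ F : Finset (Edge d), meanSize ((F : Set (Edge d)).indicator r) x ≤ K) :
    meanSize r x ≤ K := by
  unfold meanSize
  rw [ENNReal.tsum_eq_iSup_sum]
  refine iSup_le fun A => ?_
  simp_rw [connProb_eq_iSup r]
  rw [ENNReal.finsetSum_iSup_of_monotone]
  · exact iSup_le fun F => (ENNReal.sum_le_tsum A).trans (h F)
  · intro y F G hFG
    simp only [connProb_indicator]
    exact measure_mono (monotone_setOf_mem_cluster_mask x y hFG)

/-! ### Lattice automorphisms and finite truncations. -/

/-- An automorphism of the lattice acts on the edges. -/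
def edgeMap (φ : lattice d ≃g lattice d) : Edge d ≃ Edge d := φ.mapEdgeSet

theorem mem_cluster_comp_edgeMap (φ : lattice d ≃g lattice d) (ω : Config d) (x y : Fin d → ℤ) :
    y ∈ cluster (fun e => ω (edgeMap φ e)) x ↔ φ y ∈ cluster ω (φ x) := by
  let ψ : openGraph (fun e => ω (edgeMap φ e)) ≃g openGraph ω :=
    { φ.toEquiv with
      map_rel_iff' := by
        intro a b
        refine ⟨fun ⟨h, ho⟩ => ⟨φ.map_rel_iff.1 h, ho⟩, fun ⟨h, ho⟩ => ⟨φ.map_rel_iff.2 h, ho⟩⟩ }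
  exact (SimpleGraph.Iso.reachable_iff (φ := ψ)).symm

theorem connProb_comp_edgeMap (φ : lattice d ≃g lattice d) (r : Edge d → I) (x y : Fin d → ℤ) :
    connProb (fun e => r (edgeMap φ e)) x y = connProb r (φ x) (φ y) := by
  unfold connProb
  rw [← map_comp_bernoulliProduct r (edgeMap φ).injective,
    Measure.map_apply (by fun_prop) (measurableSet_mem_cluster x y)]
  congr 1
  ext ω
  exact mem_cluster_comp_edgeMap φ ω x y

theorem meanSize_comp_edgeMap (φ : lattice d ≃g lattice d) (r : Edge d → I) (x : Fin d → ℤ) :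
    meanSize (fun e => r (edgeMap φ e)) x = meanSize r (φ x) := by
  unfold meanSize
  rw [← φ.toEquiv.tsum_eq (connProb r (φ x))]
  exact tsum_congr fun y => connProb_comp_edgeMap φ r x y

/-- A cluster of a configuration with finitely many open edges is bounded independently
of its starting point. -/
theorem meanSize_indicator_finset_le (r : Edge d → I) (F : Finset (Edge d)) :
    ∃ N : ℕ, ∀ x, meanSize ((F : Set (Edge d)).indicator r) x ≤ N := by
  classical
  -- Any vertex reached other than the start is an endpoint of an edge of `F`.
  let V : Finset (Fin d → ℤ) := F.biUnion fun e => (e : Sym2 (Fin d → ℤ)).toFinset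
  refine ⟨V.card + 1, fun x => ?_⟩
  have key : ∀ y ∉ insert x V, connProb ((F : Set (Edge d)).indicator r) x y = 0 := by
    intro y hy
    rw [connProb_indicator]
    convert measure_empty (μ := bernoulliProduct r)
    refine Set.eq_empty_of_forall_notMem fun ω hω => hy ?_
    refine cluster_induction (P := fun y => y ∈ insert x V) (by simp) ?_ hω
    intro y z h ho _ _
    rw [mask_eq_true] at ho
    refine Finset.mem_insert_of_mem (Finset.mem_biUnion.2 ⟨_, ho.1, ?_⟩)
    simp
  calc meanSize ((F : Set (Edge d)).indicator r) x
      = ∑ y ∈ insert x V, connProb ((F : Set (Edge d)).indicator r) x y :=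
        tsum_eq_sum key
    _ ≤ ∑ y ∈ insert x V, 1 := Finset.sum_le_sum fun y _ => connProb_le_one _ _ _
    _ = ((insert x V).card : ℝ≥0∞) := by simp
    _ ≤ ((V.card + 1 : ℕ) : ℝ≥0∞) := by exact_mod_cast Finset.card_insert_le x V

/-! ### The exploration inequality. -/

theorem bernoulliProduct_inter {ι : Type*} (r : ι → I) {S T : Set ι} (h : Disjoint S T)
    {A B : Set (ι → Bool)} (hA : MeasurableSet A) (hB : MeasurableSet B)
    (hAS : DependsOn (· ∈ A) S) (hBT : DependsOn (· ∈ B) T) :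
    bernoulliProduct r (A ∩ B) = bernoulliProduct r A * bernoulliProduct r B := by
  have key : ∀ {S : Set ι} {A : Set (ι → Bool)}, DependsOn (· ∈ A) S →
      {ω | mask S ω ∈ A} = A := by
    intro S A hA
    ext ω
    exact iff_of_eq (hA fun i hi => mask_of_mem hi ω)
  simpa only [key hAS, key hBT] using bernoulliProduct_inter_mask r h hA hB

/-- The `2d` unit vectors of the lattice. -/
def dir (k : Fin d × Bool) : Fin d → ℤ := Pi.single k.1 (if k.2 then 1 else -1)

theorem adj_add_dir (x : Fin d → ℤ) (k : Fin d × Bool) : (lattice d).Adj x (x + dir k) := by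
  change ∑ i, |x i - (x + dir k) i| = 1
  rw [Finset.sum_eq_single k.1]
  · rcases k with ⟨i, b⟩
    cases b <;> simp [dir]
  · intro j _ hj
    simp [dir, hj]
  · simp

theorem exists_dir_of_adj {x y : Fin d → ℤ} (h : (lattice d).Adj x y) : ∃ k, y = x + dir k := by
  have h : ∑ i, |x i - y i| = 1 := h
  obtain ⟨i, hi⟩ : ∃ i, x i ≠ y i := by
    by_contra! hc
    simp [hc] at h
  have hi' : 1 ≤ |x i - y i| := Int.one_le_abs (sub_ne_zero.2 hi)
  have hsum := Finset.add_sum_erase Finset.univ (fun i => |x i - y i|) (Finset.mem_univ i)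
  have hnn : 0 ≤ ∑ j ∈ Finset.univ.erase i, |x j - y j| :=
    Finset.sum_nonneg fun j _ => abs_nonneg _
  have h0 : ∑ j ∈ Finset.univ.erase i, |x j - y j| = 0 := by linarith
  have hone : |x i - y i| = 1 := by linarith
  have hj : ∀ j, j ≠ i → y j = x j := by
    intro j hj
    have := (Finset.sum_eq_zero_iff_of_nonneg fun j _ => abs_nonneg _).1 h0 j (by simp [hj])
    linarith [abs_eq_zero.1 this]
  rcases (abs_eq zero_le_one).1 hone with h1 | h1
  · refine ⟨(i, false), funext fun j => ?_⟩
    rcases eq_or_ne j i with rfl | hne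
    · simp [dir]; linarith
    · simp [dir, hne, hj j hne]
  · refine ⟨(i, true), funext fun j => ?_⟩
    rcases eq_or_ne j i with rfl | hne
    · simp [dir]; linarith
    · simp [dir, hne, hj j hne]

/-- The edge leaving `x` in direction `k`. -/
def stepEdge (x : Fin d → ℤ) (k : Fin d × Bool) : Edge d := ⟨s(x, x + dir k), adj_add_dir x k⟩

theorem mem_stepEdge {x v : Fin d → ℤ} {k : Fin d × Bool} :
    v ∈ (stepEdge x k : Sym2 (Fin d → ℤ)) ↔ v = x ∨ v = x + dir k := Sym2.mem_iff

/-- The edges with an endpoint in `a`. -/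
def touching (a : Set (Fin d → ℤ)) : Set (Edge d) := {e | ∃ v ∈ (e : Sym2 (Fin d → ℤ)), v ∈ a}

/-- Revealing a cluster inspects only its own edges and its boundary edges, so edges not touching
`a` remain independent of the event that the cluster is `a`. -/
theorem cluster_eq_of_eqOn_touching {ω ω' : Config d} {x : Fin d → ℤ} {a : Set (Fin d → ℤ)}
    (h : ∀ e ∈ touching a, ω e = ω' e) (ha : cluster ω x = a) : cluster ω' x = a := by
  refine Set.Subset.antisymm (fun y hy => ?_) (fun y hy => ?_)
  · refine cluster_induction (P := (· ∈ a)) (ha ▸ self_mem_cluster ω x) ?_ hy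
    intro y z hl ho _ hya
    rw [← h _ ⟨y, by simp, hya⟩] at ho
    rw [← ha] at hya ⊢
    exact mem_cluster_step hya hl ho
  · rw [← ha] at hy
    refine cluster_induction (P := (· ∈ cluster ω' x)) (self_mem_cluster ω' x) ?_ hy
    intro y z hl ho hya hy'
    rw [h _ ⟨y, by simp, ha ▸ hya⟩] at ho
    exact mem_cluster_step hy' hl ho

/-- A point joined to `x` in the union of two configurations, but not in the first one, is reached
after a last visit to the cluster of `x` in the first configuration. -/
theorem exists_exit {ω η θ : Config d} (hθ : ∀ e, θ e = (ω e || η e)) {x y : Fin d → ℤ}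
    (hy : y ∈ cluster θ x) :
    y ∈ cluster ω x ∨ ∃ z ∈ cluster ω x, ∃ k, η (stepEdge z k) = true ∧
      y ∈ cluster (mask (touching (cluster ω x))ᶜ θ) (z + dir k) := by
  refine cluster_induction (P := fun y => y ∈ cluster ω x ∨ ∃ z ∈ cluster ω x, ∃ k,
    η (stepEdge z k) = true ∧ y ∈ cluster (mask (touching (cluster ω x))ᶜ θ) (z + dir k))
    (Or.inl (self_mem_cluster ω x)) ?_ hy
  intro y z hl ho _ ih
  -- A return to the cluster discards the recorded exit, so the exit kept is the last one.
  by_cases hz : z ∈ cluster ω x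
  · exact Or.inl hz
  right
  by_cases hyc : y ∈ cluster ω x
  · obtain ⟨k, rfl⟩ := exists_dir_of_adj hl
    refine ⟨y, hyc, k, ?_, self_mem_cluster _ _⟩
    rw [hθ, Bool.or_eq_true] at ho
    exact ho.resolve_left fun h => hz (mem_cluster_step hyc hl h)
  · obtain ⟨w, hw, k, hk, hyk⟩ := ih.resolve_left hyc
    refine ⟨w, hw, k, hk, mem_cluster_step hyk hl ?_⟩
    rw [mask_eq_true]
    refine ⟨?_, ho⟩
    rintro ⟨v, hv, hva⟩
    rcases Sym2.mem_iff.1 hv with rfl | rfl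
    · exact hyc hva
    · exact hz hva

/-- The first of two configurations. -/
def firstConfig (ζ : Edge d × Bool → Bool) : Config d := fun e => ζ (e, false)

/-- The union of two configurations. -/
def unionConfig (ζ : Edge d × Bool → Bool) : Config d := fun e => ζ (e, false) || ζ (e, true)

theorem measurable_firstConfig : Measurable (firstConfig (d := d)) := by
  unfold firstConfig; fun_prop

theorem measurable_unionConfig : Measurable (unionConfig (d := d)) := by
  unfold unionConfig; fun_prop

theorem pairProduct_first (r ε : Edge d → I) {A : Set (Config d)} (hA : MeasurableSet A) :
    pairProduct r ε {ζ | firstConfig ζ ∈ A} = bernoulliProduct r A := by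
  rw [← map_fst_pairProduct r ε]
  exact (Measure.map_apply measurable_firstConfig hA).symm

theorem pairProduct_union (r ε : Edge d → I) {A : Set (Config d)} (hA : MeasurableSet A) :
    pairProduct r ε {ζ | unionConfig ζ ∈ A} =
      bernoulliProduct (fun e => parOr (r e) (ε e)) A := by
  rw [← map_or_pairProduct r ε]
  exact (Measure.map_apply measurable_unionConfig hA).symm

/-- The three events use disjoint sets of bits: the first layer on edges touching `a`, the second
layer on those edges, and both layers off them. Dropping the mask only enlarges the third event. -/
theorem pairProduct_exit_le (r ε : Edge d → I) (x y z : Fin d → ℤ) (k : Fin d × Bool)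
    (a : Set (Fin d → ℤ)) (hz : z ∈ a) :
    pairProduct r ε ({ζ | cluster (firstConfig ζ) x = a} ∩ {ζ | ζ (stepEdge z k, true) = true} ∩
      {ζ | y ∈ cluster (mask (touching a)ᶜ (unionConfig ζ)) (z + dir k)}) ≤
    bernoulliProduct r {ω | cluster ω x = a} * ENNReal.ofReal (ε (stepEdge z k)) *
      connProb (fun e => parOr (r e) (ε e)) (z + dir k) y := by
  have m1 : MeasurableSet {ζ : Edge d × Bool → Bool | cluster (firstConfig ζ) x = a} :=
    measurable_firstConfig (measurableSet_cluster_eq x a)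
  have m2 : MeasurableSet {ζ : Edge d × Bool → Bool | ζ (stepEdge z k, true) = true} :=
    (measurable_pi_apply (stepEdge z k, true) :
      Measurable fun ζ : Edge d × Bool → Bool => ζ (stepEdge z k, true))
      (measurableSet_singleton true)
  have m3 : MeasurableSet {ζ : Edge d × Bool → Bool |
      y ∈ cluster (mask (touching a)ᶜ (unionConfig ζ)) (z + dir k)} :=
    ((measurable_mask _).comp measurable_unionConfig) (measurableSet_mem_cluster (z + dir k) y)
  have hzt : stepEdge z k ∈ touching a := ⟨z, mem_stepEdge.2 (Or.inl rfl), hz⟩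
  have d1 : DependsOn (· ∈ {ζ : Edge d × Bool → Bool | cluster (firstConfig ζ) x = a})
      (touching a ×ˢ {false}) := by
    intro ζ ζ' h
    refine propext ⟨fun hc => ?_, fun hc => ?_⟩
    · exact cluster_eq_of_eqOn_touching (fun e he => h (e, false) ⟨he, rfl⟩) hc
    · exact cluster_eq_of_eqOn_touching (fun e he => (h (e, false) ⟨he, rfl⟩).symm) hc
  have d2 : DependsOn (· ∈ {ζ : Edge d × Bool → Bool | ζ (stepEdge z k, true) = true})
      (touching a ×ˢ {true}) := by
    intro ζ ζ' h
    have := h (stepEdge z k, true) ⟨hzt, rfl⟩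
    simp [this]
  have d12 : DependsOn (· ∈ {ζ : Edge d × Bool → Bool | cluster (firstConfig ζ) x = a} ∩
      {ζ : Edge d × Bool → Bool | ζ (stepEdge z k, true) = true})
      (touching a ×ˢ Set.univ) := by
    intro ζ ζ' h
    have h1 := d1 (x := ζ) (y := ζ') fun i hi => h i ⟨hi.1, trivial⟩
    have h2 := d2 (x := ζ) (y := ζ') fun i hi => h i ⟨hi.1, trivial⟩
    simp only [Set.mem_inter_iff] at h1 h2 ⊢
    rw [h1, h2]
  have d3 : DependsOn (· ∈ {ζ : Edge d × Bool → Bool |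
      y ∈ cluster (mask (touching a)ᶜ (unionConfig ζ)) (z + dir k)})
      ((touching a)ᶜ ×ˢ Set.univ) := by
    intro ζ ζ' h
    have : mask (touching a)ᶜ (unionConfig ζ) = mask (touching a)ᶜ (unionConfig ζ') := by
      funext e
      by_cases he : e ∈ (touching a)ᶜ
      · rw [mask_of_mem he, mask_of_mem he, unionConfig, unionConfig, h _ ⟨he, trivial⟩,
          h _ ⟨he, trivial⟩]
      · simp [mask, he]
    simp only [Set.mem_ofPred_eq, this]
  have dis1 : Disjoint (touching a ×ˢ (Set.univ : Set Bool)) ((touching a)ᶜ ×ˢ Set.univ) :=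
    Set.disjoint_left.2 fun e h h' => h'.1 h.1
  have dis2 : Disjoint (touching a ×ˢ ({false} : Set Bool)) (touching a ×ˢ {true}) := by
    refine Set.disjoint_left.2 fun e h h' => ?_
    have h1 : e.2 = false := h.2
    have h2 : e.2 = true := h'.2
    simp [h1] at h2
  have e1 : pairProduct r ε {ζ | cluster (firstConfig ζ) x = a} =
      bernoulliProduct r {ω | cluster ω x = a} :=
    pairProduct_first r ε (measurableSet_cluster_eq x a)
  have e2 : pairProduct r ε {ζ | ζ (stepEdge z k, true) = true} =
      ENNReal.ofReal (ε (stepEdge z k)) := bernoulliProduct_eval _ _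
  have e3 : pairProduct r ε {ζ | y ∈ cluster (mask (touching a)ᶜ (unionConfig ζ)) (z + dir k)} ≤
      connProb (fun e => parOr (r e) (ε e)) (z + dir k) y := by
    unfold connProb
    rw [← pairProduct_union r ε (measurableSet_mem_cluster _ _)]
    exact measure_mono fun ζ hζ => cluster_mask_subset _ _ _ hζ
  unfold pairProduct at *
  rw [bernoulliProduct_inter _ dis1 (m1.inter m2) m3 d12 d3,
    bernoulliProduct_inter _ dis2 m1 m2 d1 d2, e1, e2]
  exact mul_le_mul_right e3 _

/-- The events for different `a` are disjoint; only an inequality results because infinite clusters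
are left out. -/
theorem tsum_cluster_eq_le (r : Edge d → I) (x z : Fin d → ℤ) :
    ∑' a : Finset (Fin d → ℤ), (a : Set (Fin d → ℤ)).indicator
      (fun _ => bernoulliProduct r {ω | cluster ω x = a}) z ≤ connProb r x z := by
  classical
  have h : ∀ a : Finset (Fin d → ℤ), (a : Set (Fin d → ℤ)).indicator
      (fun _ => bernoulliProduct r {ω | cluster ω x = a}) z =
      bernoulliProduct r {ω | z ∈ a ∧ cluster ω x = a} := by
    intro a
    by_cases hz : z ∈ a <;> simp [hz]
  simp_rw [h]
  rw [← measure_iUnion]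
  · refine measure_mono fun ω hω => ?_
    obtain ⟨a, ha, hc⟩ := Set.mem_iUnion.1 hω
    change z ∈ cluster ω x
    rw [hc]
    exact ha
  · intro a b hab
    refine Set.disjoint_left.2 fun ω h1 h2 => hab ?_
    exact Finset.coe_injective (h1.2.symm.trans h2.2)
  · intro a
    exact (MeasurableSet.const _).inter (measurableSet_cluster_eq x a)

/-- The exploration inequality: adding independent open edges. -/
theorem connProb_parOr_le (r ε : Edge d → I) (x y : Fin d → ℤ) (hx : meanSize r x ≠ ∞) :
    connProb (fun e => parOr (r e) (ε e)) x y ≤ connProb r x y +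
      ∑' z, ∑ k, connProb r x z * ENNReal.ofReal (ε (stepEdge z k)) *
        connProb (fun e => parOr (r e) (ε e)) (z + dir k) y := by
  classical
  -- Almost surely the old cluster takes values in the countable type of finite sets, which permits
  -- a union bound.
  have hfin : ∀ᵐ ζ ∂(pairProduct r ε), (cluster (firstConfig ζ) x).Finite := by
    refine ae_finite_setOfPred_mem (s := fun y => {ζ : Edge d × Bool → Bool |
      y ∈ cluster (firstConfig ζ) x}) ?_
    convert hx using 1
    exact tsum_congr fun y => pairProduct_first r ε (measurableSet_mem_cluster x y)
  let E : Finset (Fin d → ℤ) → (Fin d → ℤ) → Fin d × Bool → Set (Edge d × Bool → Bool) :=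
    fun a z k => {ζ | cluster (firstConfig ζ) x = a} ∩ {ζ | ζ (stepEdge z k, true) = true} ∩
      {ζ | y ∈ cluster (mask (touching (a : Set (Fin d → ℤ)))ᶜ (unionConfig ζ)) (z + dir k)}
  have hcover : {ζ | y ∈ cluster (unionConfig ζ) x} ≤ᵐ[pairProduct r ε]
      ({ζ | y ∈ cluster (firstConfig ζ) x} ∪
        ⋃ a : Finset (Fin d → ℤ), ⋃ z, ⋃ k, {ζ | z ∈ a ∧ ζ ∈ E a z k} : Set _) := by
    filter_upwards [hfin] with ζ hζ hy
    rcases exists_exit (ω := firstConfig ζ) (η := fun e => ζ (e, true)) (fun e => rfl) hy with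
      h | ⟨z, hz, k, hk, hyk⟩
    · exact Or.inl h
    · refine Or.inr ?_
      simp only [Set.mem_iUnion]
      refine ⟨hζ.toFinset, z, k, by simpa using hz, ⟨by simp, hk⟩, ?_⟩
      rw [Set.Finite.coe_toFinset]
      exact hyk
  have hE : ∀ a z k, pairProduct r ε {ζ | z ∈ a ∧ ζ ∈ E a z k} ≤
      (a : Set (Fin d → ℤ)).indicator (fun _ => bernoulliProduct r {ω | cluster ω x = a}) z *
        (ENNReal.ofReal (ε (stepEdge z k)) *
          connProb (fun e => parOr (r e) (ε e)) (z + dir k) y) := by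
    intro a z k
    by_cases hz : z ∈ a
    · simp only [hz, true_and, Finset.mem_coe, Set.indicator_of_mem, ← mul_assoc]
      exact pairProduct_exit_le r ε x y z k a hz
    · simp [hz]
  calc connProb (fun e => parOr (r e) (ε e)) x y
      = pairProduct r ε {ζ | y ∈ cluster (unionConfig ζ) x} :=
        (pairProduct_union r ε (measurableSet_mem_cluster x y)).symm
    _ ≤ pairProduct r ε {ζ | y ∈ cluster (firstConfig ζ) x} +
        pairProduct r ε (⋃ a : Finset (Fin d → ℤ), ⋃ z, ⋃ k, {ζ | z ∈ a ∧ ζ ∈ E a z k}) :=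
        (measure_mono_ae hcover).trans (measure_union_le _ _)
    _ ≤ connProb r x y + ∑' z, ∑ k, connProb r x z * ENNReal.ofReal (ε (stepEdge z k)) *
        connProb (fun e => parOr (r e) (ε e)) (z + dir k) y := by
      refine add_le_add (pairProduct_first r ε (measurableSet_mem_cluster x y)).le ?_
      calc _ ≤ ∑' a, ∑' z, ∑ k, pairProduct r ε {ζ | z ∈ a ∧ ζ ∈ E a z k} := by
            refine (measure_iUnion_le _).trans (ENNReal.tsum_le_tsum fun a => ?_)
            refine (measure_iUnion_le _).trans (ENNReal.tsum_le_tsum fun z => ?_)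
            exact measure_iUnion_fintype_le _ _
        _ ≤ ∑' (a : Finset (Fin d → ℤ)), ∑' z, ∑ k, (a : Set (Fin d → ℤ)).indicator
              (fun _ => bernoulliProduct r {ω | cluster ω x = a}) z *
              (ENNReal.ofReal (ε (stepEdge z k)) *
                connProb (fun e => parOr (r e) (ε e)) (z + dir k) y) :=
            ENNReal.tsum_le_tsum fun a => ENNReal.tsum_le_tsum fun z =>
              Finset.sum_le_sum fun k _ => hE a z k
        _ ≤ _ := by
            rw [ENNReal.tsum_comm]
            refine ENNReal.tsum_le_tsum fun z => ?_
            simp_rw [← Finset.mul_sum, ENNReal.tsum_mul_right, mul_assoc, ← Finset.mul_sum]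
            exact mul_le_mul_left (tsum_cluster_eq_le r x z) _

theorem meanSize_parOr_le (r ε : Edge d → I) (x : Fin d → ℤ) (hx : meanSize r x ≠ ∞) :
    meanSize (fun e => parOr (r e) (ε e)) x ≤ meanSize r x +
      ∑' z, ∑ k, connProb r x z * ENNReal.ofReal (ε (stepEdge z k)) *
        meanSize (fun e => parOr (r e) (ε e)) (z + dir k) := by
  calc meanSize (fun e => parOr (r e) (ε e)) x
      ≤ ∑' y, (connProb r x y + ∑' z, ∑ k, connProb r x z * ENNReal.ofReal (ε (stepEdge z k)) *
        connProb (fun e => parOr (r e) (ε e)) (z + dir k) y) :=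
        ENNReal.tsum_le_tsum fun y => connProb_parOr_le r ε x y hx
    _ = _ := by
        rw [ENNReal.tsum_add, ENNReal.tsum_comm]
        congr 1
        refine tsum_congr fun z => ?_
        rw [Summable.tsum_finsetSum fun _ _ => ENNReal.summable]
        refine Finset.sum_congr rfl fun k _ => ?_
        rw [ENNReal.tsum_mul_left]
        rfl

/-- A uniform bound on mean cluster sizes, from local decompositions of the edge parameters. -/
theorem meanSize_le_of_decomposition {r' : Edge d → I} {K δ : ℝ≥0∞} (hK : K ≠ ∞) (hδ : δ < 1)
    (r ε : (Fin d → ℤ) → Edge d → I) (hr : ∀ x e, parOr (r x e) (ε x e) = r' e)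
    (hrK : ∀ x, meanSize (r x) x ≤ K)
    (hrδ : ∀ x, ∑' z, ∑ k, connProb (r x) x z * ENNReal.ofReal (ε x (stepEdge z k)) ≤ δ)
    (x : Fin d → ℤ) : meanSize r' x ≤ K / (1 - δ) := by
  classical
  refine meanSize_le_of_finset fun F => ?_
  obtain ⟨N, hN⟩ := meanSize_indicator_finset_le r' F
  set M : ℝ≥0∞ := ⨆ x, meanSize ((F : Set (Edge d)).indicator r') x with hM
  -- Finiteness of `M`, the reason for truncating to `F`, allows `δ * M` to be absorbed on the left.
  have hMtop : M ≠ ∞ := ne_top_of_le_ne_top (ENNReal.natCast_ne_top N) (iSup_le hN)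
  have hstep : ∀ x, meanSize ((F : Set (Edge d)).indicator r') x ≤ K + δ * M := by
    intro x
    have hle : ∀ f : Edge d → I, (F : Set (Edge d)).indicator f ≤ f := fun f =>
      Set.indicator_le_self' fun _ _ => unitInterval.nonneg _
    have hdec : (fun e => parOr ((F : Set (Edge d)).indicator (r x) e)
        ((F : Set (Edge d)).indicator (ε x) e)) = (F : Set (Edge d)).indicator r' := by
      funext e
      by_cases he : e ∈ (F : Set (Edge d))
      · simp only [Set.indicator_of_mem he, hr]
      · simp only [Set.indicator_of_notMem he, parOr_zero_left]
    have h1 : meanSize ((F : Set (Edge d)).indicator (r x)) x ≤ K :=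
      (meanSize_mono (hle _) x).trans (hrK x)
    have h2 := meanSize_parOr_le ((F : Set (Edge d)).indicator (r x))
      ((F : Set (Edge d)).indicator (ε x)) x (ne_top_of_le_ne_top hK h1)
    rw [hdec] at h2
    refine h2.trans (add_le_add h1 ?_)
    refine le_trans ?_ (mul_le_mul_left (hrδ x) M)
    rw [← ENNReal.tsum_mul_right]
    refine ENNReal.tsum_le_tsum fun z => ?_
    rw [Finset.sum_mul]
    refine Finset.sum_le_sum fun k _ => ?_
    gcongr
    · exact connProb_mono (hle _) x z
    · exact hle (ε x) _
    · exact le_iSup (fun x => meanSize ((F : Set (Edge d)).indicator r') x) (z + dir k)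
  have hMle : M ≤ K + δ * M := iSup_le hstep
  have h3 : M ≤ K / (1 - δ) := by
    rw [ENNReal.le_div_iff_mul_le (Or.inl (tsub_pos_of_lt hδ).ne')
      (Or.inl (ne_top_of_le_ne_top ENNReal.one_ne_top tsub_le_self)), ENNReal.mul_sub
        (fun _ _ => hMtop), mul_one, tsub_le_iff_right, mul_comm M δ]
    exact hMle
  exact (le_iSup (fun x => meanSize ((F : Set (Edge d)).indicator r') x) x).trans h3

/-! ### Translations and coordinate permutations. -/

/-- Translation by `v`. -/
def translation (v : Fin d → ℤ) : lattice d ≃g lattice d where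
  toEquiv := Equiv.addRight v
  map_rel_iff' := by simp [lattice]

@[simp]
theorem translation_apply (v x : Fin d → ℤ) : translation v x = x + v := rfl

/-- Permutation of the coordinates. -/
def permutation (π : Equiv.Perm (Fin d)) : lattice d ≃g lattice d where
  toEquiv := π.arrowCongr (Equiv.refl ℤ)
  map_rel_iff' {x y} := by
    simp only [lattice, Equiv.arrowCongr_apply, Equiv.coe_refl, Function.comp_apply, id]
    rw [Equiv.sum_comp π.symm fun i => |x i - y i|]

@[simp]
theorem permutation_apply (π : Equiv.Perm (Fin d)) (x : Fin d → ℤ) (i : Fin d) :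
    permutation π x i = x (π.symm i) := rfl

theorem mem_edgeMap {φ : lattice d ≃g lattice d} {e : Edge d} {v : Fin d → ℤ}
    (hv : v ∈ (e : Sym2 (Fin d → ℤ))) : φ v ∈ (edgeMap φ e : Sym2 (Fin d → ℤ)) :=
  Sym2.mem_map.2 ⟨v, hv, rfl⟩

theorem exists_of_mem_edgeMap {φ : lattice d ≃g lattice d} {e : Edge d} {v : Fin d → ℤ}
    (hv : v ∈ (edgeMap φ e : Sym2 (Fin d → ℤ))) :
    ∃ w ∈ (e : Sym2 (Fin d → ℤ)), φ w = v := Sym2.mem_map.1 hv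

theorem edgeMap_translation_stepEdge (v x : Fin d → ℤ) (k : Fin d × Bool) :
    edgeMap (translation v) (stepEdge x k) = stepEdge (x + v) k := by
  apply Subtype.ext
  change Sym2.map (translation v) s(x, x + dir k) = s(x + v, x + v + dir k)
  rw [Sym2.map_mk]
  simp [add_right_comm]

theorem connProb_comm (r : Edge d → I) (x y : Fin d → ℤ) : connProb r x y = connProb r y x := by
  unfold connProb
  congr 1
  ext ω
  exact SimpleGraph.reachable_comm

/-- As `r₀` closes the edge from `x` to `x + dir k`, the connection from `x` to `y` can be realised
without it, independently of its state; opening it prolongs the connection. -/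
theorem connProb_mul_le (r r₀ : Edge d → I) (h : r₀ ≤ r) (x y : Fin d → ℤ) (k : Fin d × Bool)
    (h0 : r₀ (stepEdge x k) = 0) :
    connProb r₀ x y * ENNReal.ofReal (r (stepEdge x k)) ≤ connProb r (x + dir k) y := by
  classical
  have h1 : r₀ ≤ ({stepEdge x k}ᶜ : Set (Edge d)).indicator r := by
    intro e
    by_cases he : e = stepEdge x k
    · simp [he, h0]
    · rw [Set.indicator_of_mem (by simpa using he)]
      exact h e
  refine (mul_le_mul_left (connProb_mono h1 x y) _).trans ?_
  rw [connProb_indicator, ← bernoulliProduct_eval,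
    ← bernoulliProduct_inter r (S := {stepEdge x k}ᶜ) (T := {stepEdge x k})
      disjoint_compl_left]
  · refine measure_mono fun ω hω => ?_
    refine SimpleGraph.Reachable.trans ?_ (cluster_mask_subset _ _ _ hω.1)
    exact SimpleGraph.Adj.reachable (SimpleGraph.Adj.symm ⟨adj_add_dir x k, hω.2⟩)
  · exact measurable_mask _ (measurableSet_mem_cluster x y)
  · exact (measurable_pi_apply (stepEdge x k) :
      Measurable fun ω : Config d => ω (stepEdge x k)) (measurableSet_singleton true)
  · intro ω ω' hω
    have : mask ({stepEdge x k}ᶜ : Set (Edge d)) ω = mask {stepEdge x k}ᶜ ω' := by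
      funext e
      by_cases he : e ∈ ({stepEdge x k}ᶜ : Set (Edge d))
      · rw [mask_of_mem he, mask_of_mem he, hω e he]
      · simp only [mask, he, if_false]
    simp only [Set.mem_ofPred_eq, this]
  · intro ω ω' hω
    simp only [Set.mem_ofPred_eq, hω (stepEdge x k) rfl]

/-! ### Boxes, exits and homogeneous percolation. -/

/-- The box `[-n, n]^d`. -/
def box (d n : ℕ) : Finset (Fin d → ℤ) := Fintype.piFinset fun _ => Finset.Icc (-n : ℤ) n

theorem mem_box {n : ℕ} {x : Fin d → ℤ} : x ∈ box d n ↔ ∀ i, |x i| ≤ n := by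
  simp [box, abs_le]

/-- The edges with both endpoints in the box. -/
def boxEdges (d n : ℕ) : Set (Edge d) := {e | ∀ x ∈ (e : Sym2 (Fin d → ℤ)), x ∈ box d n}

theorem connProb_boxEdges_eq_zero (r : Edge d → I) {n : ℕ} {y : Fin d → ℤ} (hy : y ∉ box d n) :
    connProb ((boxEdges d n).indicator r) 0 y = 0 := by
  rw [connProb_indicator]
  convert measure_empty (μ := bernoulliProduct r)
  refine Set.eq_empty_of_forall_notMem fun ω hω => hy ?_
  refine cluster_induction (P := (· ∈ box d n)) (by simp [mem_box]) ?_ hω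
  intro y z h ho _ _
  exact (mask_eq_true.1 ho).1 z (by simp)

theorem meanSize_boxEdges_le (r : Edge d → I) (n : ℕ) :
    meanSize ((boxEdges d n).indicator r) 0 ≤ (box d n).card := by
  unfold meanSize
  rw [tsum_eq_sum fun y hy => connProb_boxEdges_eq_zero r hy]
  calc _ ≤ ∑ y ∈ box d n, (1 : ℝ≥0∞) := Finset.sum_le_sum fun y _ => connProb_le_one _ _ _
    _ = _ := by simp

/-- The expected number of open edges leaving the box which are joined to the origin inside. -/
def exitSum (d n : ℕ) (p : I) : ℝ≥0∞ :=
  ∑' z, ∑ k, connProb ((boxEdges d n).indicator fun _ => p) 0 z *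
    ENNReal.ofReal ((boxEdges d n)ᶜ.indicator (fun _ => p) (stepEdge z k) : I)

/-- The decomposition at `x` first opens edges in the box centred at `x` and then adds all the
others; by translation its coefficients sum to `exitSum`. -/
theorem exists_meanSize_const_le {n : ℕ} {p : I} (h : exitSum d n p < 1) :
    ∃ K : ℝ≥0∞, K ≠ ∞ ∧ ∀ x : Fin d → ℤ, meanSize (fun _ => p) x ≤ K := by
  classical
  refine ⟨(box d n).card / (1 - exitSum d n p), ENNReal.div_ne_top (ENNReal.natCast_ne_top _)
    (tsub_pos_of_lt h).ne', meanSize_le_of_decomposition (ENNReal.natCast_ne_top _) h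
    (fun x e => (boxEdges d n).indicator (fun _ => p) (edgeMap (translation (-x)) e))
    (fun x e => (boxEdges d n)ᶜ.indicator (fun _ => p) (edgeMap (translation (-x)) e)) ?_ ?_ ?_⟩
  · intro x e
    by_cases he : edgeMap (translation (-x)) e ∈ boxEdges d n
    · simp [he, parOr_zero_right]
    · simp [he, parOr_zero_left]
  · intro x
    rw [meanSize_comp_edgeMap (translation (-x)) ((boxEdges d n).indicator fun _ => p)]
    simpa using meanSize_boxEdges_le (fun _ => p) n
  · intro x
    refine le_of_eq ?_
    refine Eq.trans ?_ ((Equiv.addRight (-x)).tsum_eq fun z => ∑ k,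
      connProb ((boxEdges d n).indicator fun _ => p) 0 z *
        ENNReal.ofReal ((boxEdges d n)ᶜ.indicator (fun _ => p) (stepEdge z k) : I))
    refine tsum_congr fun z => Finset.sum_congr rfl fun k _ => ?_
    rw [connProb_comp_edgeMap (translation (-x)) ((boxEdges d n).indicator fun _ => p),
      edgeMap_translation_stepEdge]
    simp

theorem abs_add_dir_of_exit {n : ℕ} {z : Fin d → ℤ} {k : Fin d × Bool} (hz : z ∈ box d n)
    (hk : stepEdge z k ∉ boxEdges d n) : |(z + dir k) k.1| = n + 1 := by
  have h : z + dir k ∉ box d n := by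
    intro h
    refine hk fun v hv => ?_
    rcases mem_stepEdge.1 hv with rfl | rfl
    · exact hz
    · exact h
  rw [mem_box] at hz h
  push Not at h
  obtain ⟨i, hi⟩ := h
  have hik : i = k.1 := by
    by_contra hne
    have : (z + dir k) i = z i := by simp [dir, hne]
    rw [this] at hi
    exact absurd (hz i) (not_le.2 hi)
  subst hik
  refine le_antisymm ?_ hi
  refine (abs_add_le _ _).trans (add_le_add (hz _) ?_)
  rcases k with ⟨i, b⟩
  cases b <;> simp [dir]

/-- Send the exit vertex to the origin and swap the exit coordinate with the transverse one `j`. No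
box vertex shares the exit vertex's coordinate `k.1`, so the image of the box misses H and the box
edges and exit edge all have parameter `p`. -/
theorem exit_term_le {s : ℕ} (p q : I) {j : Fin d} (hj : s ≤ j) {n : ℕ} {z : Fin d → ℤ}
    {k : Fin d × Bool} (hz : z ∈ box d n) (hk : stepEdge z k ∉ boxEdges d n) :
    connProb ((boxEdges d n).indicator fun _ => p) 0 z * ENNReal.ofReal p ≤
      connProb (edgeParam d s p q) 0
        (permutation (Equiv.swap k.1 j) (-(z + dir k))) := by
  classical
  let φ : lattice d ≃g lattice d :=
    (translation (-(z + dir k))).trans (permutation (Equiv.swap k.1 j))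
  have hφ : ∀ x, φ x = permutation (Equiv.swap k.1 j) (x - (z + dir k)) := by
    intro x
    rw [sub_eq_add_neg]
    rfl
  have habs := abs_add_dir_of_exit hz hk
  have hne : ∀ x ∈ box d n, φ x ∉ sublattice d s := by
    intro x hx hH
    have h0 := hH j hj
    rw [hφ, permutation_apply, Equiv.symm_swap, Equiv.swap_apply_right, Pi.sub_apply,
      sub_eq_zero] at h0
    have := mem_box.1 hx k.1
    rw [h0, habs] at this
    linarith
  have hparam : ∀ e : Edge d, (∃ v ∈ (e : Sym2 (Fin d → ℤ)), v ∈ box d n) →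
      edgeParam d s p q (edgeMap φ e) = p := by
    rintro e ⟨v, hv, hvb⟩
    exact if_neg fun h => hne v hvb (h _ (mem_edgeMap hv))
  have hle : (boxEdges d n).indicator (fun _ => p) ≤
      fun e => edgeParam d s p q (edgeMap φ e) := by
    intro e
    by_cases he : e ∈ boxEdges d n
    · rw [Set.indicator_of_mem he]
      refine (hparam e ?_).ge
      obtain ⟨v, hv⟩ : ∃ v, v ∈ (e : Sym2 (Fin d → ℤ)) := ⟨_, Sym2.out_fst_mem _⟩
      exact ⟨v, hv, he v hv⟩
    · rw [Set.indicator_of_notMem he]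
      exact unitInterval.nonneg _
  have h := connProb_mul_le _ _ hle z 0 k (Set.indicator_of_notMem hk _)
  rw [hparam _ ⟨z, mem_stepEdge.2 (Or.inl rfl), hz⟩, connProb_comp_edgeMap, connProb_comm] at h
  have e1 : φ (z + dir k) = 0 := by
    rw [hφ, sub_self]
    rfl
  rwa [e1, hφ 0, zero_sub] at h

theorem tsum_ite_succ_eq_le (m : ℕ) (c : ℝ≥0∞) :
    ∑' n : ℕ, (if n + 1 = m then c else 0) ≤ c := by
  cases m with
  | zero => simp
  | succ m => simp [tsum_ite_eq]

theorem tsum_exitSum_le {s : ℕ} (hs : s < d) (p q : I) :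
    ∑' n, exitSum d n p ≤ (2 * d : ℕ) * meanSize (edgeParam d s p q) 0 := by
  classical
  obtain ⟨j, hj⟩ : ∃ j : Fin d, s ≤ j := ⟨⟨s, hs⟩, le_rfl⟩
  let c : (Fin d → ℤ) → Fin d × Bool → ℝ≥0∞ := fun z k =>
    connProb (edgeParam d s p q) 0 (permutation (Equiv.swap k.1 j) (-(z + dir k)))
  -- The pair `(z, k)` determines the only box it can exit, since the exit vertex has coordinate
  -- `k.1` of modulus `n + 1`. So summing over `n` costs no extra factor.
  have hterm : ∀ n z k, connProb ((boxEdges d n).indicator fun _ => p) 0 z *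
      ENNReal.ofReal ((boxEdges d n)ᶜ.indicator (fun _ => p) (stepEdge z k) : I) ≤
      if n + 1 = ((z + dir k) k.1).natAbs then c z k else 0 := by
    intro n z k
    by_cases hz : z ∈ box d n
    · by_cases hk : stepEdge z k ∈ boxEdges d n
      · simp [hk]
      · have habs := abs_add_dir_of_exit hz hk
        rw [Int.abs_eq_natAbs] at habs
        rw [if_pos (by exact_mod_cast habs.symm), Set.indicator_of_mem hk]
        exact exit_term_le p q hj hz hk
    · simp [connProb_boxEdges_eq_zero _ hz]
  have hsum : ∀ k, ∑' z, c z k = meanSize (edgeParam d s p q) 0 := by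
    intro k
    exact ((Equiv.addRight (dir k)).trans ((Equiv.neg _).trans
      (permutation (Equiv.swap k.1 j)).toEquiv)).tsum_eq (connProb (edgeParam d s p q) 0)
  calc ∑' n, exitSum d n p
      ≤ ∑' n : ℕ, ∑' z, ∑ k, (if n + 1 = ((z + dir k) k.1).natAbs then c z k else 0) :=
        ENNReal.tsum_le_tsum fun n => ENNReal.tsum_le_tsum fun z =>
          Finset.sum_le_sum fun k _ => hterm n z k
    _ = ∑' z, ∑ k, ∑' n : ℕ, (if n + 1 = ((z + dir k) k.1).natAbs then c z k else 0) := by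
        rw [ENNReal.tsum_comm]
        refine tsum_congr fun z => ?_
        rw [Summable.tsum_finsetSum fun _ _ => ENNReal.summable]
    _ ≤ ∑' z, ∑ k, c z k := ENNReal.tsum_le_tsum fun z => Finset.sum_le_sum fun k _ =>
        tsum_ite_succ_eq_le _ _
    _ = ∑ k, ∑' z, c z k := Summable.tsum_finsetSum fun _ _ => ENNReal.summable
    _ = (2 * d : ℕ) * meanSize (edgeParam d s p q) 0 := by
        simp only [hsum, Finset.sum_const, nsmul_eq_mul, Finset.card_univ, Fintype.card_prod,
          Fintype.card_fin, Fintype.card_bool, mul_comm d 2]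

theorem exists_exitSum_lt_one {s : ℕ} (hs : s < d) {p q : I}
    (h : meanSize (edgeParam d s p q) 0 ≠ ∞) : ∃ n, exitSum d n p < 1 := by
  by_contra! hc
  have h1 : ∑' n : ℕ, (1 : ℝ≥0∞) ≤ ∑' n, exitSum d n p := ENNReal.tsum_le_tsum hc
  rw [ENNReal.tsum_const_eq_top_of_ne_zero one_ne_zero] at h1
  exact ENNReal.mul_ne_top (ENNReal.natCast_ne_top _) h
    (top_le_iff.1 (h1.trans (tsum_exitSum_le hs p q)))

/-! ### The uniform bound over all starting points. -/

theorem meanSize_edgeParam_of_mem {s : ℕ} (p q : I) {x : Fin d → ℤ} (hx : x ∈ sublattice d s) :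
    meanSize (edgeParam d s p q) x = meanSize (edgeParam d s p q) 0 := by
  classical
  have hmem : ∀ v, v + x ∈ sublattice d s ↔ v ∈ sublattice d s := by
    intro v
    refine forall_congr' fun i => forall_congr' fun hi => ?_
    simp [hx i hi]
  have h := meanSize_comp_edgeMap (translation x) (edgeParam d s p q) 0
  rw [translation_apply, zero_add] at h
  rw [← h]
  congr 1
  funext e
  have : edgeMap (translation x) e ∈ sublatticeEdges d s ↔ e ∈ sublatticeEdges d s := by
    refine ⟨fun he v hv => (hmem v).1 (he _ (mem_edgeMap hv)), fun he v hv => ?_⟩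
    obtain ⟨w, hw, rfl⟩ := exists_of_mem_edgeMap hv
    exact (hmem w).2 (he w hw)
  simp [edgeParam, this]

theorem sum_dir_const (c : ℝ≥0∞) : ∑ _k : Fin d × Bool, c = (2 * d : ℕ) * c := by
  rw [Finset.sum_const, nsmul_eq_mul, Finset.card_univ, Fintype.card_prod, Fintype.card_fin,
    Fintype.card_bool, mul_comm d 2]

/-- If the mean cluster size is finite at the origin then it is bounded over all vertices. -/
theorem exists_meanSize_edgeParam_le {s : ℕ} (hsd : s ≤ d) {p q : I}
    (h : meanSize (edgeParam d s p q) 0 ≠ ∞) :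
    ∃ K : ℝ≥0∞, K ≠ ∞ ∧ ∀ x : Fin d → ℤ, meanSize (edgeParam d s p q) x ≤ K := by
  classical
  rcases hsd.eq_or_lt with rfl | hlt
  · exact ⟨_, h, fun x => (meanSize_edgeParam_of_mem p q fun i hi =>
      absurd i.2 (not_lt.2 hi)).le⟩
  obtain ⟨n, hn⟩ := exists_exitSum_lt_one hlt h
  obtain ⟨K, hK, hbulk⟩ := exists_meanSize_const_le hn
  have hK' : ∀ x, meanSize (edgeParam d s p 0) x ≤ K := by
    refine fun x => (meanSize_mono (fun e => ?_) x).trans (hbulk x)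
    unfold edgeParam
    split_ifs
    · exact unitInterval.nonneg _
    · exact le_rfl
  refine ⟨K + K * ((2 * d : ℕ) * meanSize (edgeParam d s p q) 0), by finiteness, fun x => ?_⟩
  -- The bulk is explored with the edges of H closed; these are then the only edges added.
  have hdec : (fun e => parOr (edgeParam d s p 0 e) (edgeParam d s 0 q e)) =
      edgeParam d s p q := by
    funext e
    unfold edgeParam
    split_ifs
    · exact parOr_zero_left q
    · exact parOr_zero_right p
  have hmain := meanSize_parOr_le (edgeParam d s p 0) (edgeParam d s 0 q) x
    (ne_top_of_le_ne_top hK (hK' x))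
  rw [hdec] at hmain
  refine hmain.trans (add_le_add (hK' x) ?_)
  calc _ ≤ ∑' z, connProb (edgeParam d s p 0) x z *
        ((2 * d : ℕ) * meanSize (edgeParam d s p q) 0) := by
        refine ENNReal.tsum_le_tsum fun z => ?_
        rw [← sum_dir_const, Finset.mul_sum]
        refine Finset.sum_le_sum fun k _ => ?_
        rw [mul_assoc]
        refine mul_le_mul_right ?_ _
        -- An added edge ends in H, where the mean size is that of the origin; all other edges have
        -- weight zero.
        by_cases hzk : stepEdge z k ∈ sublatticeEdges d s
        · rw [meanSize_edgeParam_of_mem p q (hzk _ (mem_stepEdge.2 (Or.inr rfl)))]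
          refine (mul_le_mul_left (ENNReal.ofReal_le_one.2 (unitInterval.le_one _)) _).trans ?_
          rw [one_mul]
        · simp [edgeParam, hzk]
    _ ≤ _ := by
        rw [ENNReal.tsum_mul_right]
        exact mul_le_mul_left (hK' x) _

/-! ### Openness by sprinkling. -/

theorem setOf_le_parOr_mem_nhds (p : I) {c : I} (hc : 0 < c) :
    {p' | p' ≤ parOr p c} ∈ nhds p := by
  -- At `p = 1` sprinkling gains nothing, but no larger parameter exists in the unit interval.
  rcases eq_or_ne p 1 with rfl | hp
  · have : {p' : I | p' ≤ parOr 1 c} = Set.univ := by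
      ext x
      simpa [parOr] using unitInterval.le_one' (t := x)
    rw [this]
    exact Filter.univ_mem
  · refine Iic_mem_nhds ?_
    have hp1 : (p : ℝ) < 1 := unitInterval.coe_lt_one.2 (unitInterval.lt_one_iff_ne_one.2 hp)
    have hc0 : (0 : ℝ) < c := hc
    change (p : ℝ) < parOr p c
    rw [coe_parOr]
    nlinarith

theorem exists_pos_mul_lt_one {A : ℝ≥0∞} (hA : A ≠ ∞) :
    ∃ c : I, 0 < c ∧ A * ENNReal.ofReal c < 1 := by
  have hA0 : 0 ≤ A.toReal := ENNReal.toReal_nonneg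
  have hpos : 0 < 1 / (A.toReal + 1) := by positivity
  refine ⟨⟨1 / (A.toReal + 1), hpos.le, ?_⟩, hpos, ?_⟩
  · rw [div_le_one (by positivity)]
    linarith
  · change A * ENNReal.ofReal (1 / (A.toReal + 1)) < 1
    nth_rw 1 [← ENNReal.ofReal_toReal hA]
    rw [← ENNReal.ofReal_mul hA0, ENNReal.ofReal_lt_one, mul_one_div, div_lt_one (by positivity)]
    linarith

theorem isOpen_subcriticalSet {s : ℕ} (hsd : s ≤ d) : IsOpen (subcriticalSet d s) := by
  classical
  rw [isOpen_iff_mem_nhds]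
  rintro ⟨p, q⟩ h
  have h : expectedClusterSize d s p q < ∞ := h
  rw [expectedClusterSize_eq] at h
  obtain ⟨K, hK, hKx⟩ := exists_meanSize_edgeParam_le hsd h.ne
  -- Each of at most `K` expected cluster vertices has `2 * d` incident edges, each added with
  -- probability `c`.
  obtain ⟨c, hc, hδ⟩ := exists_pos_mul_lt_one (A := K * (2 * d : ℕ))
    (ENNReal.mul_ne_top hK (ENNReal.natCast_ne_top _))
  have hfin := meanSize_le_of_decomposition hK hδ (fun _ => edgeParam d s p q) (fun _ _ => c)
    (fun _ _ => rfl) hKx (fun x => by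
      simp_rw [← Finset.sum_mul, sum_dir_const, ENNReal.tsum_mul_right, ENNReal.tsum_mul_left]
      rw [mul_comm K]
      exact mul_le_mul_left (mul_le_mul_right (hKx x) _) _) 0
  filter_upwards [prod_mem_nhds (setOf_le_parOr_mem_nhds p hc) (setOf_le_parOr_mem_nhds q hc)]
    with ⟨p', q'⟩ ⟨hp', hq'⟩
  change expectedClusterSize d s p' q' < ∞
  rw [expectedClusterSize_eq]
  refine lt_of_le_of_lt ((meanSize_mono ?_ 0).trans hfin)
    (ENNReal.div_lt_top hK (tsub_pos_of_lt hδ).ne')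
  intro e
  simp only [edgeParam]
  split_ifs
  · exact hq'
  · exact hp'

end DefectPercolation

end

theorem mainTheorem3 (d s : ℕ) (hs : 1 ≤ s) (hsd : s ≤ d) :
    IsOpen (DefectPercolation.subcriticalSet d s) :=
  DefectPercolation.isOpen_subcriticalSet hsd
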